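/- Let $M$ be a smooth manifold of dimension $2n+1$ with an almost contact B-metric structure $(\varphi,\xi,\eta,g)$: $\varphi$ is a smooth field of endomorphisms of $TM$, $\xi$ a smooth vector field, $\eta$ a smooth 1-form and $g$ a pseudo-Riemannian metric of signature $(n+1,n)$ such that $$\varphi\xi=0,\quad \varphi^2=-\mathrm{id}+\eta\otimes\xi,\quad \eta\circ\varphi=0,\quad \eta(\xi)=1,\quad g(\varphi x,\varphi y)=-g(x,y)+\eta(x)\eta(y).$$ Let $\tilde g(x,y)=g(x,\varphi y)+\eta(x)\eta(y)$ be the associated metric, $\nabla$ the Levi-Civita connection of $g$, $\rho$ the Ricci tensor of $g$ (with $R(x,y)=[\nabla_x,\nabla_y]-\nabla_{[x,y]}$ and $\rho(y,z)=\operatorname{tr}(x\mapsto R(x,y)z)$), and $\tau$, $\tilde\tau$ the scalar curvatures of $g$ and $\tilde g$. Suppose that $M$ is * Sasaki-like: $(\nabla_x\varphi)y=-g(x,y)\xi-\eta(y)x+2\eta(x)\eta(y)\xi$ for all $x,y$; * Einstein-like: $\rho=a\,g+b\,\tilde g+c\,\eta\otimes\eta$ for some real constants $a,b,c$; and that $M$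 admits a Ricci-like soliton with potential a smooth vector field $v$, i.e. for some real constants $\lambda,\mu,\nu$ $$\tfrac12\mathcal L_v g+\rho+\lambda\,g+\mu\,\tilde g+\nu\,\eta\otimes\eta=0 .$$ Then $\rho=2n\,\eta\otimes\eta$ and $\tau=\tilde\tau=2n$ on $M$. -/

import Mathlib

open scoped Manifold ContDiff Matrix

noncomputable section

/-- The model space `ℝᵐ` of `m`-dimensional manifolds. -/
abbrev Model (m : ℕ) : Type := EuclideanSpace ℝ (Fin m)

/-! ## Pseudo-Riemannian calculus in coordinates

`G : Model m → (Model m →L[ℝ] Model m →L[ℝ] ℝ)` is (the coordinate expression of) a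
pseudo-Riemannian metric on an open subset of `ℝᵐ`, `z` a point of this subset, and `x`, `y`, `w`
are tangent vectors at `z`, i.e. elements of `ℝᵐ`. -/

namespace Coord

variable {m : ℕ}

/-- The `i`-th coordinate vector field `∂ᵢ`. -/
def basisVec (i : Fin m) : Model m := EuclideanSpace.single i 1

/-- Christoffel symbols of the Levi-Civita connection of `G`: `Γ_z(x, y)` is the vector with
`G(Γ(x, y), t) = ½ (∂ₓ G (y, t) + ∂_y G (x, t) - ∂_t G (x, y))` for all `t`. -/
def christoffel (G : Model m → Model m →L[ℝ] Model m →L[ℝ] ℝ) (z x y : Model m) : Model m :=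
  (G z).inverse ((1 / 2 : ℝ) •
    (fderiv ℝ G z x y + fderiv ℝ G z y x - ((fderiv ℝ G z).flip x).flip y))

/-- `(∇ₓ P) y` for a field `P` of endomorphisms, `∇` the Levi-Civita connection of `G`. -/
def covDerivEnd (G : Model m → Model m →L[ℝ] Model m →L[ℝ] ℝ)
    (P : Model m → Model m →L[ℝ] Model m) (z x y : Model m) : Model m :=
  fderiv ℝ P z x y + christoffel G z x (P z y) - P z (christoffel G z x y)

/-- The curvature tensor `R(x, y) w = ∇ₓ ∇_y w - ∇_y ∇ₓ w - ∇_[x, y] w` of the Levi-Civita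
connection of `G`; `x`, `y`, `w` are extended by constant fields, for which `[x, y] = 0`. -/
def curvature (G : Model m → Model m →L[ℝ] Model m →L[ℝ] ℝ) (z x y w : Model m) : Model m :=
  fderiv ℝ (fun z' => christoffel G z' y w) z x - fderiv ℝ (fun z' => christoffel G z' x w) z y
    + christoffel G z x (christoffel G z y w) - christoffel G z y (christoffel G z x w)

/-- The Ricci tensor `ρ(y, w)`, the trace of `x ↦ R(x, y) w`. -/
def ricci (G : Model m → Model m →L[ℝ] Model m →L[ℝ] ℝ) (z y w : Model m) : ℝ :=
  ∑ i, curvature G z (basisVec i) y w i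

/-- The Gram matrix `(gᵢⱼ)` of `G` in the coordinate frame. -/
def gram (G : Model m → Model m →L[ℝ] Model m →L[ℝ] ℝ) (z : Model m) :
    Matrix (Fin m) (Fin m) ℝ :=
  Matrix.of fun i j => G z (basisVec i) (basisVec j)

/-- The scalar curvature `gⁱʲ ρ(eᵢ, eⱼ)`. -/
def scalarCurvature (G : Model m → Model m →L[ℝ] Model m →L[ℝ] ℝ) (z : Model m) : ℝ :=
  ∑ i, ∑ j, (gram G z)⁻¹ i j * ricci G z (basisVec i) (basisVec j)

/-- The Lie derivative `(L_V B)(x, y)` of a bilinear form `B` along the vector field `V`. -/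
def lieDeriv (V : Model m → Model m) (B : Model m → Model m →L[ℝ] Model m →L[ℝ] ℝ)
    (z x y : Model m) : ℝ :=
  fderiv ℝ B z (V z) x y + B z (fderiv ℝ V z x) y + B z x (fderiv ℝ V z y)

end Coord

/-! ## Tensor fields on a manifold and their expressions in a chart

`e : OpenPartialHomeomorph M (Model m)` is a chart; the coordinate expression of a tensor field
at `z ∈ e.target` is its pullback along the differential of `e.symm` at `z`. -/

section Charts

variable {m : ℕ} {M : Type*} [TopologicalSpace M] [ChartedSpace (Model m) M]

/-- The differential of the local parametrization `e.symm` at `z`. -/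
def chartFrame (e : OpenPartialHomeomorph M (Model m)) (z : Model m) :
    Model m →L[ℝ] TangentSpace (𝓡 m) (e.symm z) :=
  mfderiv 𝓘(ℝ, Model m) (𝓡 m) e.symm z

def coordVec (e : OpenPartialHomeomorph M (Model m)) (X : (p : M) → TangentSpace (𝓡 m) p)
    (z : Model m) : Model m :=
  (chartFrame e z).inverse (X (e.symm z))

def coordForm (e : OpenPartialHomeomorph M (Model m))
    (α : (p : M) → TangentSpace (𝓡 m) p →L[ℝ] ℝ) (z : Model m) : Model m →L[ℝ] ℝ :=
  (α (e.symm z)).comp (chartFrame e z)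

def coordEnd (e : OpenPartialHomeomorph M (Model m))
    (P : (p : M) → TangentSpace (𝓡 m) p →L[ℝ] TangentSpace (𝓡 m) p) (z : Model m) :
    Model m →L[ℝ] Model m :=
  (chartFrame e z).inverse.comp ((P (e.symm z)).comp (chartFrame e z))

def coordBilin (e : OpenPartialHomeomorph M (Model m))
    (B : (p : M) → TangentSpace (𝓡 m) p →L[ℝ] TangentSpace (𝓡 m) p →L[ℝ] ℝ) (z : Model m) :
    Model m →L[ℝ] Model m →L[ℝ] ℝ :=
  (ContinuousLinearMap.precomp ℝ (chartFrame e z)).comp ((B (e.symm z)).comp (chartFrame e z))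

/-- A vector field is smooth. -/
def SmoothVec (X : (p : M) → TangentSpace (𝓡 m) p) [IsManifold (𝓡 m) ∞ M] : Prop :=
  ContMDiff (𝓡 m) (𝓡 m).tangent ∞
    (fun p => (⟨p, X p⟩ : TangentBundle (𝓡 m) M))

/-- A 1-form is smooth. -/
def SmoothForm (α : (p : M) → TangentSpace (𝓡 m) p →L[ℝ] ℝ) [IsManifold (𝓡 m) ∞ M] : Prop :=
  ContMDiff (𝓡 m) ((𝓡 m).prod 𝓘(ℝ, Model m →L[ℝ] ℝ)) ∞
    (fun p => Bundle.TotalSpace.mk' (Model m →L[ℝ] ℝ)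
      (E := fun p : M => TangentSpace (𝓡 m) p →L[ℝ] ℝ) p (α p))

/-- A field of endomorphisms of the tangent bundle is smooth. -/
def SmoothEnd (P : (p : M) → TangentSpace (𝓡 m) p →L[ℝ] TangentSpace (𝓡 m) p)
    [IsManifold (𝓡 m) ∞ M] : Prop :=
  ContMDiff (𝓡 m) ((𝓡 m).prod 𝓘(ℝ, Model m →L[ℝ] Model m)) ∞
    (fun p => Bundle.TotalSpace.mk' (Model m →L[ℝ] Model m)
      (E := fun p : M => TangentSpace (𝓡 m) p →L[ℝ] TangentSpace (𝓡 m) p) p (P p))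

/-- A field of bilinear forms on the tangent bundle is smooth. -/
def SmoothBilin (B : (p : M) → TangentSpace (𝓡 m) p →L[ℝ] TangentSpace (𝓡 m) p →L[ℝ] ℝ)
    [IsManifold (𝓡 m) ∞ M] : Prop :=
  ContMDiff (𝓡 m) ((𝓡 m).prod 𝓘(ℝ, Model m →L[ℝ] Model m →L[ℝ] ℝ)) ∞
    (fun p => Bundle.TotalSpace.mk' (Model m →L[ℝ] Model m →L[ℝ] ℝ)
      (E := fun p : M => TangentSpace (𝓡 m) p →L[ℝ] TangentSpace (𝓡 m) p →L[ℝ] ℝ) p (B p))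

end Charts

/-! ## Almost contact B-metric manifolds -/

/-- An almost contact B-metric structure `(φ, ξ, η, g)` on the smooth manifold `M` of dimension
`2n+1`; `g` has signature `(n+1, n)`. -/
structure AlmostContactBMetric (n : ℕ) (M : Type*) [TopologicalSpace M]
    [ChartedSpace (Model (2 * n + 1)) M] [IsManifold (𝓡 (2 * n + 1)) ∞ M] where
  φ : (p : M) → TangentSpace (𝓡 (2 * n + 1)) p →L[ℝ] TangentSpace (𝓡 (2 * n + 1)) p
  ξ : (p : M) → TangentSpace (𝓡 (2 * n + 1)) p
  η : (p : M) → TangentSpace (𝓡 (2 * n + 1)) p →L[ℝ] ℝ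
  g : (p : M) → TangentSpace (𝓡 (2 * n + 1)) p →L[ℝ] TangentSpace (𝓡 (2 * n + 1)) p →L[ℝ] ℝ
  smooth_φ : SmoothEnd φ
  smooth_ξ : SmoothVec ξ
  smooth_η : SmoothForm η
  smooth_g : SmoothBilin g
  φ_ξ : ∀ p, φ p (ξ p) = 0
  φ_φ : ∀ p x, φ p (φ p x) = -x + η p x • ξ p
  η_φ : ∀ p x, η p (φ p x) = 0
  η_ξ : ∀ p, η p (ξ p) = 1
  g_symm : ∀ p x y, g p x y = g p y x
  /-- the signature of `g` is `(n+1, n)` -/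
  g_signature : ∀ p, ∃ b : Module.Basis (Fin (n + 1) ⊕ Fin n) ℝ (TangentSpace (𝓡 (2 * n + 1)) p),
    (∀ i j, i ≠ j → g p (b i) (b j) = 0) ∧ (∀ i, g p (b (Sum.inl i)) (b (Sum.inl i)) = 1) ∧
      (∀ i, g p (b (Sum.inr i)) (b (Sum.inr i)) = -1)
  g_φ_φ : ∀ p x y, g p (φ p x) (φ p y) = -g p x y + η p x * η p y

namespace AlmostContactBMetric

variable {n : ℕ} {M : Type*} [TopologicalSpace M] [ChartedSpace (Model (2 * n + 1)) M]
  [IsManifold (𝓡 (2 * n + 1)) ∞ M] (S : AlmostContactBMetric n M)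

/-- The associated metric `g̃(x, y) = g(x, φ y) + η(x) η(y)`. -/
def gTilde (p : M) :
    TangentSpace (𝓡 (2 * n + 1)) p →L[ℝ] TangentSpace (𝓡 (2 * n + 1)) p →L[ℝ] ℝ :=
  (ContinuousLinearMap.precomp ℝ (S.φ p)).comp (S.g p) + (S.η p).smulRight (S.η p)

theorem gTilde_apply (p : M) (x y : TangentSpace (𝓡 (2 * n + 1)) p) :
    S.gTilde p x y = S.g p x (S.φ p y) + S.η p x * S.η p y := by
  simp [gTilde]

/-- Sasaki-like: `(∇ₓ φ) y = -g(x, y) ξ - η(y) x + 2 η(x) η(y) ξ`, `∇` being the Levi-Civita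
connection of `g`. As all tensor identities below, this is expressed in every chart `e` of the
smooth structure, at every point `z` of its coordinate domain. -/
def IsSasakiLike : Prop :=
  ∀ e ∈ IsManifold.maximalAtlas (𝓡 (2 * n + 1)) ∞ M, ∀ z ∈ e.target,
    ∀ x y : Model (2 * n + 1),
      Coord.covDerivEnd (coordBilin e S.g) (coordEnd e S.φ) z x y =
        -(coordBilin e S.g z x y) • coordVec e S.ξ z - (coordForm e S.η z y) • x
          + (2 * coordForm e S.η z x * coordForm e S.η z y) • coordVec e S.ξ z

/-- Einstein-like: `ρ = a g + b g̃ + c η ⊗ η` for constants `a`, `b`, `c`. -/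
def IsEinsteinLike : Prop :=
  ∃ a b c : ℝ, ∀ e ∈ IsManifold.maximalAtlas (𝓡 (2 * n + 1)) ∞ M, ∀ z ∈ e.target,
    ∀ x y : Model (2 * n + 1),
      Coord.ricci (coordBilin e S.g) z x y =
        a * coordBilin e S.g z x y + b * coordBilin e S.gTilde z x y
          + c * (coordForm e S.η z x * coordForm e S.η z y)

/-- The manifold admits a Ricci-like soliton with potential `v`:
`½ L_v g + ρ + l g + μ g̃ + ν η ⊗ η = 0` for constants `l`, `μ`, `ν`. -/
def AdmitsRicciLikeSoliton (v : (p : M) → TangentSpace (𝓡 (2 * n + 1)) p) : Prop :=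
  ∃ l μ ν : ℝ, ∀ e ∈ IsManifold.maximalAtlas (𝓡 (2 * n + 1)) ∞ M, ∀ z ∈ e.target,
    ∀ x y : Model (2 * n + 1),
      (1 / 2 : ℝ) * Coord.lieDeriv (coordVec e v) (coordBilin e S.g) z x y
        + Coord.ricci (coordBilin e S.g) z x y + l * coordBilin e S.g z x y
        + μ * coordBilin e S.gTilde z x y
        + ν * (coordForm e S.η z x * coordForm e S.η z y) = 0

end AlmostContactBMetric

end

/-!
The proof is a computation in the domain of a chart. Write `F(x, y) = g(x, φ y)`.

The Sasaki-like condition, applied to `y = ξ`, gives `∇ₓ ξ = -φ x` (`fderiv_ξ`), and hence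
`R(x, y) ξ = η(y) x - η(x) y` (`curv_ξ`), so that `ρ(ξ, ξ) = 2n`. By the symmetries of the curvature
tensor, `R(ξ, x) y = g(x, y) ξ - η(y) x`, and this determines the Lie derivative of the Levi-Civita
connection along `ξ`: `L_ξ ∇ = 2 (g - η ⊗ η) ⊗ ξ` (`lieConn_ξ`).

The main point is that a change of connection of the form `S ⊗ ξ`, where
`S = β (g - η ⊗ η) + γ F` with constants `β`, `γ`, leaves the Ricci tensor unchanged
to first order (`tr_covDerivBi_formTimes`): the trace of `u ↦ (∇ᵤ (S ⊗ ξ))(x, y) - (∇ₓ (S ⊗ ξ))(u, y)` vanishes,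
since `∇_ξ S = 0`, `S(ξ, ·) = 0` and `tr φ = 0`. It is used twice.

* For `S = 2 (g - η ⊗ η)` it yields `L_ξ ρ = 0` (`lie_ricci`), the Lie derivative of the curvature
  being the exterior covariant derivative of `L_ξ ∇` (`lieCurv_eq`). On the other hand
  `L_ξ g = -2 F`, `L_ξ F = 2 (g - η ⊗ η)` and `L_ξ η = 0`, so for the Einstein-like tensor
  `ρ = a g + b g̃ + c η ⊗ η` one gets `a F = b (g - η ⊗ η)`. Composing with `φ`, also
  `a (g - η ⊗ η) + b F = 0`, that is `ρ = (a + b + c) η ⊗ η = 2n η ⊗ η`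
  (`ricci_eq_of_einstein`).
* For `S = -(g - η ⊗ η) - F` it yields `ρ̃ = ρ` (`ricci_associated`), because `S ⊗ ξ` is the
  difference of the Levi-Civita connections of `g̃` and `g` (`christoffel_associated`) and the terms
  of second order vanish by `S(·, ξ) = 0`.

As `η` is dual to `ξ` with respect to both metrics, both traces of `ρ` are `2n η(ξ) = 2n`.
-/

set_option maxSynthPendingDepth 3

noncomputable section

/-! ### Connections, their curvature and Lie derivatives -/

namespace AffineConnection

theorem minSmoothness_le_infty : minSmoothness ℝ 2 ≤ (∞ : WithTop ℕ∞) := by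
  simp only [minSmoothness_of_isRCLikeNormedField]
  exact WithTop.coe_le_coe.2 (le_top : (2 : ℕ∞) ≤ ⊤)

variable {E : Type*} [NormedAddCommGroup E] [NormedSpace ℝ E]

/-- The curvature `R(x, y) w = ∇ₓ ∇_y w - ∇_y ∇ₓ w - ∇_[x, y] w` of the connection with Christoffel
symbols `Γ`, evaluated on constant fields. -/
def curv (Γ : E → E →L[ℝ] E →L[ℝ] E) (z x y w : E) : E :=
  fderiv ℝ Γ z x y w - fderiv ℝ Γ z y x w + Γ z x (Γ z y w) - Γ z y (Γ z x w)

/-- The Lie derivative `(L_ξ ∇)(x, y) = [ξ, ∇ₓ y] - ∇_[ξ, x] y - ∇ₓ [ξ, y]` of a connection,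
evaluated on constant fields. The second derivative of `ξ` appears because `Γ` is not a tensor. -/
def lieConn (ξ : E → E) (Γ : E → E →L[ℝ] E →L[ℝ] E) (z x y : E) : E :=
  fderiv ℝ Γ z (ξ z) x y + Γ z (fderiv ℝ ξ z x) y + Γ z x (fderiv ℝ ξ z y)
    - fderiv ℝ ξ z (Γ z x y) + fderiv ℝ (fderiv ℝ ξ) z x y

/-- The covariant derivative `(∇ᵤ C)(x, y)` of a vector-valued bilinear form `C`. -/
def covDerivBi (Γ C : E → E →L[ℝ] E →L[ℝ] E) (z u x y : E) : E :=
  fderiv ℝ C z u x y + Γ z u (C z x y) - C z (Γ z u x) y - C z x (Γ z u y)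

/-- The Lie derivative `(L_ξ R)(u, x) y` of the curvature tensor. -/
def lieCurv (ξ : E → E) (Γ : E → E →L[ℝ] E →L[ℝ] E) (z u x y : E) : E :=
  fderiv ℝ (fun z' => curv Γ z' u x y) z (ξ z) + curv Γ z (fderiv ℝ ξ z u) x y
    + curv Γ z u (fderiv ℝ ξ z x) y + curv Γ z u x (fderiv ℝ ξ z y)
    - fderiv ℝ ξ z (curv Γ z u x y)

/-- Differentiability of the curvature and the product rule for its derivative. -/
theorem fderiv_curv {Γ : E → E →L[ℝ] E →L[ℝ] E} {z : E} (hΓ : DifferentiableAt ℝ Γ z)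
    (hΓ' : DifferentiableAt ℝ (fderiv ℝ Γ) z) (u x y t : E) :
    DifferentiableAt ℝ (fun z' => curv Γ z' u x y) z ∧
    fderiv ℝ (fun z' => curv Γ z' u x y) z t =
      fderiv ℝ (fderiv ℝ Γ) z t u x y - fderiv ℝ (fderiv ℝ Γ) z t x u y
      + (fderiv ℝ Γ z t u (Γ z x y) + Γ z u (fderiv ℝ Γ z t x y))
      - (fderiv ℝ Γ z t x (Γ z u y) + Γ z x (fderiv ℝ Γ z t u y)) := by
  have c (a : E) : HasFDerivAt (𝕜 := ℝ) (fun _ : E => a) 0 z := hasFDerivAt_const a z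
  have h2 (a b d : E) := (((hΓ'.hasFDerivAt).clm_apply (c a)).clm_apply (c b)).clm_apply (c d)
  have h3 (a b d : E) := (hΓ.hasFDerivAt.clm_apply (c a)).clm_apply
    ((hΓ.hasFDerivAt.clm_apply (c b)).clm_apply (c d))
  have h : HasFDerivAt (fun z' => curv Γ z' u x y) _ z :=
    (((h2 u x y).sub (h2 x u y)).add (h3 u x y)).sub (h3 x u y)
  refine ⟨h.differentiableAt, ?_⟩
  have e := h.fderiv
  have e2 := congrArg (fun L : E →L[ℝ] E => L t) e
  refine Eq.trans e2 ?_
  simp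
  module

/-- The curvature changes under a flow by the exterior covariant derivative of the change of the
connection: `(L_ξ R)(u, x) y = (∇ᵤ C)(x, y) - (∇ₓ C)(u, y)` for `C = L_ξ ∇`. -/
theorem lieCurv_eq {U : Set E} (hU : IsOpen U) {Γ C : E → E →L[ℝ] E →L[ℝ] E} {ξ : E → E}
    (hΓ : ContDiffOn ℝ ∞ Γ U) (hξ : ContDiffOn ℝ ∞ ξ U)
    (hsymm : ∀ z ∈ U, ∀ x y, Γ z x y = Γ z y x)
    (hC : ∀ z ∈ U, ∀ x y, lieConn ξ Γ z x y = C z x y)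
    {z : E} (hz : z ∈ U) (hCd : DifferentiableAt ℝ C z) (u x y : E) :
    lieCurv ξ Γ z u x y = covDerivBi Γ C z u x y - covDerivBi Γ C z x u y := by
  have hzU := hU.mem_nhds hz
  have aΓ := hΓ.contDiffAt hzU
  have aξ := hξ.contDiffAt hzU
  have aξ1 : ContDiffAt ℝ ∞ (fderiv ℝ ξ) z := aξ.fderiv_right (by simp)
  have aΓ1 : ContDiffAt ℝ ∞ (fderiv ℝ Γ) z := aΓ.fderiv_right (by simp)
  have dΓ := aΓ.differentiableAt (by simp)
  have dΓ1 := aΓ1.differentiableAt (by simp)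
  have dξ := aξ.differentiableAt (by simp)
  have dξ1 := aξ1.differentiableAt (by simp)
  have dξ2 := (aξ1.fderiv_right (m := ∞) (by simp)).differentiableAt (by simp)
  have sΓ : IsSymmSndFDerivAt ℝ Γ z := aΓ.isSymmSndFDerivAt minSmoothness_le_infty
  have sξ : IsSymmSndFDerivAt ℝ ξ z := aξ.isSymmSndFDerivAt minSmoothness_le_infty
  have sξ1 : IsSymmSndFDerivAt ℝ (fderiv ℝ ξ) z := aξ1.isSymmSndFDerivAt minSmoothness_le_infty
  have key (u x : E) : fderiv ℝ C z u x y =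
      fderiv ℝ (fderiv ℝ Γ) z u (ξ z) x y + fderiv ℝ Γ z (fderiv ℝ ξ z u) x y
      + (fderiv ℝ Γ z u (fderiv ℝ ξ z x) y + Γ z (fderiv ℝ (fderiv ℝ ξ) z u x) y)
      + (fderiv ℝ Γ z u x (fderiv ℝ ξ z y) + Γ z x (fderiv ℝ (fderiv ℝ ξ) z u y))
      - (fderiv ℝ (fderiv ℝ ξ) z u (Γ z x y) + fderiv ℝ ξ z (fderiv ℝ Γ z u x y))
      + fderiv ℝ (fderiv ℝ (fderiv ℝ ξ)) z u x y := by
    have c (a : E) : HasFDerivAt (𝕜 := ℝ) (fun _ : E => a) 0 z := hasFDerivAt_const a z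
    have hΓd := dΓ.hasFDerivAt
    have g1 := (((dΓ1.hasFDerivAt).clm_apply dξ.hasFDerivAt).clm_apply (c x)).clm_apply (c y)
    have g2 := (hΓd.clm_apply (dξ1.hasFDerivAt.clm_apply (c x))).clm_apply (c y)
    have g3 := (hΓd.clm_apply (c x)).clm_apply (dξ1.hasFDerivAt.clm_apply (c y))
    have g4 := dξ1.hasFDerivAt.clm_apply ((hΓd.clm_apply (c x)).clm_apply (c y))
    have g5 := (dξ2.hasFDerivAt.clm_apply (c x)).clm_apply (c y)
    have g := (((g1.add g2).add g3).sub g4).add g5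
    have gC := (hCd.hasFDerivAt.clm_apply (c x)).clm_apply (c y)
    have ev : (fun z' => C z' x y) =ᶠ[nhds z] fun z' => lieConn ξ Γ z' x y := by
      filter_upwards [hzU] with z' hz' using (hC z' hz' x y).symm
    have e1 := (gC.congr_of_eventuallyEq ev.symm).unique g
    have e2 := congrArg (fun L : E →L[ℝ] E => L u) e1
    simp at e2
    rw [e2]
    module
  rw [lieCurv, (fderiv_curv dΓ dΓ1 u x y (ξ z)).2]
  have hs := hsymm z hz
  simp only [curv, covDerivBi, key, ← hC z hz, lieConn, map_add, map_sub]
  rw [sΓ (ξ z) u, sΓ (ξ z) x, sξ1 x u, sξ x u, hs x u]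
  module

end AffineConnection

/-! ### The Levi-Civita connection in coordinates -/

namespace Coord

variable {m : ℕ}

/-- `G` is a smooth pseudo-Riemannian metric (of any signature) on the open set `U`. -/
structure IsMetricOn (U : Set (Model m)) (G : Model m → Model m →L[ℝ] Model m →L[ℝ] ℝ) :
    Prop where
  isOpen : IsOpen U
  smooth : ContDiffOn ℝ ∞ G U
  symm : ∀ z ∈ U, ∀ x y, G z x y = G z y x
  nondeg : ∀ z ∈ U, ∀ x, (∀ y, G z x y = 0) → x = 0

/-- The right-hand side of the Koszul formula as a function of the derivative `T` of the metric. -/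
def koszul (T : Model m →L[ℝ] Model m →L[ℝ] Model m →L[ℝ] ℝ) :
    Model m →L[ℝ] Model m →L[ℝ] Model m →L[ℝ] ℝ :=
  (1 / 2 : ℝ) • (T + T.flip -
    ((ContinuousLinearMap.flipₗᵢ ℝ (Model m) (Model m) ℝ).toContinuousLinearEquiv :
      (Model m →L[ℝ] Model m →L[ℝ] ℝ) →L[ℝ] (Model m →L[ℝ] Model m →L[ℝ] ℝ)).comp T.flip)

theorem koszul_apply (T : Model m →L[ℝ] Model m →L[ℝ] Model m →L[ℝ] ℝ) (x y t : Model m) :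
    koszul T x y t = 1 / 2 * (T x y t + T y x t - T t x y) := by
  simp [koszul]

/-- `christoffel` bundled as a continuous bilinear map, so that it can be differentiated in the
point. -/
def christoffelCLM (G : Model m → Model m →L[ℝ] Model m →L[ℝ] ℝ) (z : Model m) :
    Model m →L[ℝ] Model m →L[ℝ] Model m :=
  (ContinuousLinearMap.compL ℝ (Model m) (Model m →L[ℝ] ℝ) (Model m) (G z).inverse).comp
    (koszul (fderiv ℝ G z))

theorem christoffel_eq (G : Model m → Model m →L[ℝ] Model m →L[ℝ] ℝ) (z x y : Model m) :
    christoffel G z x y = christoffelCLM G z x y := by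
  have : (1 / 2 : ℝ) • (fderiv ℝ G z x y + fderiv ℝ G z y x - ((fderiv ℝ G z).flip x).flip y)
      = koszul (fderiv ℝ G z) x y := by
    ext t; simp [koszul_apply]
  simp [christoffel, christoffelCLM, ← this]

/-- The algebraic symmetries of a curvature tensor imply its pair symmetry. -/
theorem pair_symm_of_skew {V : Type*} (f : V → V → V → V → ℝ)
    (h₁ : ∀ x y w t, f x y w t = -f x y t w) (h₂ : ∀ x y w t, f x y w t = -f y x w t)
    (h₃ : ∀ x y w t, f x y w t + f y w x t + f w x y t = 0) (x y w t : V) :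
    f x y w t = f w t x y := by
  have b1 := h₃ x y w t
  have b2 := h₃ y w t x
  have b3 := h₃ w t x y
  have b4 := h₃ t x y w
  grind

namespace IsMetricOn

variable {U : Set (Model m)} {G : Model m → Model m →L[ℝ] Model m →L[ℝ] ℝ} (hG : IsMetricOn U G)
include hG

theorem isInvertible {z : Model m} (hz : z ∈ U) : (G z).IsInvertible := by
  have hinj : Function.Injective (G z).toLinearMap := by
    rw [← LinearMap.ker_eq_bot, LinearMap.ker_eq_bot']
    intro x hx
    exact hG.nondeg z hz x fun y => congrArg (fun L : Model m →L[ℝ] ℝ => L y) hx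
  have hfr : Module.finrank ℝ (Model m) = Module.finrank ℝ (Model m →L[ℝ] ℝ) :=
    (InnerProductSpace.toDual ℝ (Model m)).toLinearEquiv.finrank_eq
  refine ⟨(LinearEquiv.ofInjectiveOfFinrankEq (G z).toLinearMap hinj hfr).toContinuousLinearEquiv,
    ?_⟩
  ext x y
  rfl

theorem apply_christoffel {z : Model m} (hz : z ∈ U) (x y t : Model m) :
    G z (christoffelCLM G z x y) t =
      1 / 2 * (fderiv ℝ G z x y t + fderiv ℝ G z y x t - fderiv ℝ G z t x y) := by
  rw [← koszul_apply]
  simp only [christoffelCLM, ContinuousLinearMap.comp_apply, ContinuousLinearMap.compL_apply]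
  rw [(hG.isInvertible hz).self_apply_inverse]

theorem ext {z : Model m} (hz : z ∈ U) {x y : Model m} (h : ∀ t, G z x t = G z y t) : x = y := by
  rw [← sub_eq_zero]
  exact hG.nondeg z hz _ fun t => by simp [h]

theorem differentiableAt {z : Model m} (hz : z ∈ U) : DifferentiableAt ℝ G z :=
  (hG.smooth.contDiffAt (hG.isOpen.mem_nhds hz)).differentiableAt (by simp)

theorem fderiv_symm {z : Model m} (hz : z ∈ U) (u x y : Model m) :
    fderiv ℝ G z u x y = fderiv ℝ G z u y x := by
  have c (a : Model m) : HasFDerivAt (𝕜 := ℝ) (fun _ : Model m => a) 0 z := hasFDerivAt_const a z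
  have h (x y : Model m) := ((hG.differentiableAt hz).hasFDerivAt.clm_apply (c x)).clm_apply (c y)
  have e := ((h x y).congr_of_eventuallyEq
    (by filter_upwards [hG.isOpen.mem_nhds hz] with z' hz' using hG.symm z' hz' y x)).unique (h y x)
  simpa using congrArg (fun L : Model m →L[ℝ] ℝ => L u) e

theorem christoffel_symm {z : Model m} (hz : z ∈ U) (x y : Model m) :
    christoffelCLM G z x y = christoffelCLM G z y x :=
  hG.ext hz fun t => by
    rw [hG.apply_christoffel hz, hG.apply_christoffel hz, hG.fderiv_symm hz t x y]; ring

/-- The Levi-Civita connection is metric. -/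
theorem fderiv_eq {z : Model m} (hz : z ∈ U) (u x y : Model m) :
    fderiv ℝ G z u x y = G z (christoffelCLM G z u x) y + G z x (christoffelCLM G z u y) := by
  rw [hG.symm z hz x, hG.apply_christoffel hz, hG.apply_christoffel hz, hG.fderiv_symm hz u x y,
    hG.fderiv_symm hz y u x, hG.fderiv_symm hz x u y]; ring

theorem contDiffOn_christoffel : ContDiffOn ℝ ∞ (christoffelCLM G) U := by
  intro z hz
  have hzU := hG.isOpen.mem_nhds hz
  have h0 := hG.smooth.contDiffAt hzU
  have h1 : ContDiffAt ℝ ∞ (fderiv ℝ G) z := h0.fderiv_right (by simp)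
  have hflip : ContDiffAt ℝ ∞ (fun z => (fderiv ℝ G z).flip) z :=
    (ContinuousLinearMap.flipₗᵢ ℝ (Model m) (Model m)
      (Model m →L[ℝ] ℝ)).toContinuousLinearEquiv.contDiff.contDiffAt.comp z h1
  have hk : ContDiffAt ℝ ∞ (fun z => koszul (fderiv ℝ G z)) z := by
    unfold koszul
    exact ((h1.add hflip).sub (contDiffAt_const.clm_comp hflip)).const_smul _
  have hi : ContDiffAt ℝ ∞ (fun z => (G z).inverse) z :=
    ((hG.isInvertible hz).contDiffAt_map_inverse).comp z h0
  have hc : ContDiffAt ℝ ∞ (fun z => ContinuousLinearMap.compL ℝ (Model m) (Model m →L[ℝ] ℝ)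
      (Model m) (G z).inverse) z :=
    (ContinuousLinearMap.compL ℝ (Model m) (Model m →L[ℝ] ℝ)
      (Model m)).contDiff.contDiffAt.comp z hi
  exact (hc.clm_comp hk).contDiffWithinAt

/-- The Levi-Civita connection is the only torsion-free metric one. -/
theorem christoffel_unique {z : Model m} (hz : z ∈ U) {D : Model m → Model m → Model m}
    (hsymm : ∀ x y, D x y = D y x)
    (hD : ∀ u x y, fderiv ℝ G z u x y = G z (D u x) y + G z x (D u y)) (x y : Model m) :
    christoffelCLM G z x y = D x y :=
  hG.ext hz fun t => by
    rw [hG.apply_christoffel hz, hD, hD, hD, hsymm y x, hsymm t x, hsymm t y,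
      hG.symm z hz y (D x t), hG.symm z hz x (D y t)]; ring

open AffineConnection

theorem differentiableAt_christoffel {z : Model m} (hz : z ∈ U) :
    DifferentiableAt ℝ (christoffelCLM G) z :=
  (hG.contDiffOn_christoffel.contDiffAt (hG.isOpen.mem_nhds hz)).differentiableAt (by simp)

theorem curvature_eq {z : Model m} (hz : z ∈ U) (x y w : Model m) :
    curvature G z x y w = curv (christoffelCLM G) z x y w := by
  have c (a : Model m) : HasFDerivAt (𝕜 := ℝ) (fun _ : Model m => a) 0 z := hasFDerivAt_const a z
  have h (x y : Model m) :=
    ((hG.differentiableAt_christoffel hz).hasFDerivAt.clm_apply (c x)).clm_apply (c y)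
  simp only [curvature, curv, christoffel_eq]
  rw [(h y w).fderiv, (h x w).fderiv]
  simp

/-- Skew symmetry in the last two arguments: the second derivative of `G` is symmetric. -/
theorem curv_skew {z : Model m} (hz : z ∈ U) (x y w t : Model m) :
    G z (curv (christoffelCLM G) z x y w) t = -G z w (curv (christoffelCLM G) z x y t) := by
  have hzU := hG.isOpen.mem_nhds hz
  have aG := hG.smooth.contDiffAt hzU
  have sG : IsSymmSndFDerivAt ℝ G z := aG.isSymmSndFDerivAt minSmoothness_le_infty
  have dG := (hG.differentiableAt hz).hasFDerivAt
  have dΓ := (hG.differentiableAt_christoffel hz).hasFDerivAt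
  have a1 : ContDiffAt ℝ ∞ (fderiv ℝ G) z := aG.fderiv_right (by simp)
  have d1 := (a1.differentiableAt (by simp)).hasFDerivAt
  have c (a : Model m) : HasFDerivAt (𝕜 := ℝ) (fun _ : Model m => a) 0 z := hasFDerivAt_const a z
  have key (x y : Model m) : fderiv ℝ (fderiv ℝ G) z x y w t =
      fderiv ℝ G z x (christoffelCLM G z y w) t + G z (fderiv ℝ (christoffelCLM G) z x y w) t
      + (fderiv ℝ G z x w (christoffelCLM G z y t)
        + G z w (fderiv ℝ (christoffelCLM G) z x y t)) := by
    have h1 := ((d1.clm_apply (c y)).clm_apply (c w)).clm_apply (c t)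
    have h2 := ((dG.clm_apply ((dΓ.clm_apply (c y)).clm_apply (c w))).clm_apply (c t)).add
      ((dG.clm_apply (c w)).clm_apply ((dΓ.clm_apply (c y)).clm_apply (c t)))
    have e := (h1.congr_of_eventuallyEq
      (by filter_upwards [hzU] with z' hz' using (hG.fderiv_eq hz' y w t).symm)).unique h2
    have e2 := congrArg (fun L : Model m →L[ℝ] ℝ => L x) e
    simp at e2
    linear_combination e2
  have h := sG x y
  have h' := congrArg (fun L : Model m →L[ℝ] Model m →L[ℝ] ℝ => L w t) h
  simp only [key, hG.fderiv_eq hz] at h'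
  simp only [curv, map_add, map_sub, add_apply, sub_apply]
  linear_combination h'

theorem fderiv_christoffel_symm {z : Model m} (hz : z ∈ U) (u x y : Model m) :
    fderiv ℝ (christoffelCLM G) z u x y = fderiv ℝ (christoffelCLM G) z u y x := by
  have dΓ := (hG.differentiableAt_christoffel hz).hasFDerivAt
  have c (a : Model m) : HasFDerivAt (𝕜 := ℝ) (fun _ : Model m => a) 0 z := hasFDerivAt_const a z
  have h (x y : Model m) := (dΓ.clm_apply (c x)).clm_apply (c y)
  have e := ((h x y).congr_of_eventuallyEq (by
    filter_upwards [hG.isOpen.mem_nhds hz] with z' hz' using hG.christoffel_symm hz' y x)).unique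
      (h y x)
  simpa using congrArg (fun L : Model m →L[ℝ] Model m => L u) e

theorem curv_bianchi {z : Model m} (hz : z ∈ U) (x y w : Model m) :
    curv (christoffelCLM G) z x y w + curv (christoffelCLM G) z y w x
      + curv (christoffelCLM G) z w x y = 0 := by
  have hs := hG.fderiv_christoffel_symm hz
  simp only [curv]
  rw [hs x w y, hs y x w, hs w y x, hG.christoffel_symm hz w x, hG.christoffel_symm hz y x,
    hG.christoffel_symm hz w y]
  module

theorem curv_pair {z : Model m} (hz : z ∈ U) (x y w t : Model m) :
    G z (curv (christoffelCLM G) z x y w) t = G z (curv (christoffelCLM G) z w t x) y := by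
  have b (x y w t : Model m) := congrArg (fun v => G z v t) (hG.curv_bianchi hz x y w)
  have s1 (x y w t : Model m) : G z (curv (christoffelCLM G) z x y w) t =
      -G z (curv (christoffelCLM G) z x y t) w := by
    rw [hG.curv_skew hz, hG.symm z hz]
  have s2 (x y w t : Model m) : G z (curv (christoffelCLM G) z x y w) t =
      -G z (curv (christoffelCLM G) z y x w) t := by
    have : curv (christoffelCLM G) z x y w = -curv (christoffelCLM G) z y x w := by
      simp only [curv]; module
    rw [this]; simp
  simp only [map_add, map_zero, add_apply, zero_apply] at b
  exact pair_symm_of_skew (fun x y w t => G z (curv (christoffelCLM G) z x y w) t) s1 s2 b x y w t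

end IsMetricOn

/-! ### Traces of vector-valued functions on `ℝᵐ` -/

/-- The trace of a map of `ℝᵐ` into itself, meaningful for linear maps; `ricci` is of this form. -/
def tr (f : Model m → Model m) : ℝ := ∑ i, f (basisVec i) i

theorem tr_eq_trace (L : Model m →L[ℝ] Model m) : tr L = LinearMap.trace ℝ _ L.toLinearMap := by
  rw [LinearMap.trace_eq_matrix_trace ℝ (EuclideanSpace.basisFun (Fin m) ℝ).toBasis]
  simp [tr, Matrix.trace, LinearMap.toMatrix_apply, basisVec]

theorem sum_basisVec (v : Model m) : ∑ i, v i • basisVec i = v := by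
  simpa [basisVec] using (EuclideanSpace.basisFun (Fin m) ℝ).sum_repr v

theorem tr_smul_vector {α : Model m → ℝ} (hα : IsLinearMap ℝ α) (v : Model m) :
    tr (fun u => α u • v) = α v := by
  have h : α v = ∑ i, v i * α (basisVec i) := by
    conv_lhs => rw [← sum_basisVec v]
    change hα.mk' α (∑ i, v i • basisVec i) = _
    simp
  simp [h, tr, mul_comm]

theorem tr_id : tr (fun u : Model m => u) = m := by
  simp [tr, basisVec]

theorem tr_add (f g : Model m → Model m) : tr (fun u => f u + g u) = tr f + tr g := by
  simp [tr, Finset.sum_add_distrib]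

theorem tr_sub (f g : Model m → Model m) : tr (fun u => f u - g u) = tr f - tr g := by
  simp [tr, Finset.sum_sub_distrib]

theorem tr_smul (a : ℝ) (f : Model m → Model m) : tr (fun u => a • f u) = a * tr f := by
  simp [tr, Finset.mul_sum]

theorem tr_comp_comm (A : Model m →L[ℝ] Model m) {B : Model m → Model m}
    (hB : IsLinearMap ℝ B) : tr (fun u => A (B u)) = tr fun u => B (A u) := by
  let B' : Model m →L[ℝ] Model m := (hB.mk' B).toContinuousLinearMap
  have := LinearMap.trace_mul_comm ℝ A.toLinearMap B'.toLinearMap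
  exact (tr_eq_trace (A.comp B')).trans (this.trans (tr_eq_trace (B'.comp A)).symm)

/-- If `P³ = -P`, the complex eigenvalues of `P` are among `0`, `±i`, so the real number `tr P` is
purely imaginary. -/
theorem tr_eq_zero_of_cube (P : Model m →L[ℝ] Model m) (h : ∀ x, P (P (P x)) = -P x) :
    tr P = 0 := by
  let A := LinearMap.toMatrix (EuclideanSpace.basisFun (Fin m) ℝ).toBasis
    (EuclideanSpace.basisFun (Fin m) ℝ).toBasis P.toLinearMap
  have hA : A ^ 3 = -A := by
    have : P.toLinearMap ^ 3 = -P.toLinearMap := by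
      ext1 x
      simpa [pow_succ] using h x
    have h2 := congrArg (LinearMap.toMatrix (EuclideanSpace.basisFun (Fin m) ℝ).toBasis
      (EuclideanSpace.basisFun (Fin m) ℝ).toBasis) this
    rw [map_neg] at h2
    rw [← h2]
    exact LinearMap.toMatrix_pow _ P.toLinearMap 3
  have htr : tr P = A.trace := by
    rw [tr_eq_trace, LinearMap.trace_eq_matrix_trace ℝ (EuclideanSpace.basisFun (Fin m) ℝ).toBasis]
  let B : Matrix (Fin m) (Fin m) ℂ := A.map (algebraMap ℝ ℂ)
  have hB : B ^ 3 = -B := by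
    have := congrArg (fun M : Matrix (Fin m) (Fin m) ℝ => M.map (algebraMap ℝ ℂ)) hA
    rw [Matrix.map_pow] at this
    exact this.trans (Matrix.map_neg _ (by simp) _)
  have htB : (B.trace).re = A.trace := by
    simp [B, Matrix.trace]
  rw [htr, ← htB, Matrix.trace_eq_sum_roots_charpoly_of_splits (IsAlgClosed.splits _)]
  have hroot : ∀ μ ∈ B.charpoly.roots, μ.re = 0 := by
    intro μ hμ
    have hsp : μ ∈ spectrum ℂ B :=
      Matrix.mem_spectrum_of_isRoot_charpoly (Polynomial.isRoot_of_mem_roots hμ)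
    have h0 := spectrum.subset_polynomial_aeval B (Polynomial.X ^ 3 + Polynomial.X)
      ⟨μ, hsp, rfl⟩
    have hne : Nontrivial (Matrix (Fin m) (Fin m) ℂ) := by
      by_contra hn
      rw [not_nontrivial_iff_subsingleton] at hn
      simp [spectrum.of_subsingleton] at hsp
    have h1 : μ * (μ ^ 2 + 1) = 0 := by
      simp [hB] at h0
      linear_combination h0
    rcases mul_eq_zero.1 h1 with h2 | h2
    · simp [h2]
    · have hre := congrArg Complex.re h2
      have him := congrArg Complex.im h2
      simp [pow_two] at hre him
      have : μ.re * μ.im = 0 := by linarith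
      rcases mul_eq_zero.1 this with h3 | h3
      · exact h3
      · rw [h3] at hre; nlinarith
  have hsum (s : Multiset ℂ) : (∀ μ ∈ s, μ.re = 0) → s.sum.re = 0 := by
    induction s using Multiset.induction_on with
    | empty => simp
    | cons a s ih => intro h; simp_all
  exact hsum _ hroot

end Coord

/-! ### Curvature of Sasaki-like structures in coordinates -/

namespace Coord

open AffineConnection

variable {m : ℕ}

theorem fderiv_apply₂ {F : Type*} [NormedAddCommGroup F] [NormedSpace ℝ F]
    {T : Model m → Model m →L[ℝ] Model m →L[ℝ] F} {z : Model m}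
    (h : DifferentiableAt ℝ T z) (x y : Model m) :
    HasFDerivAt (fun z' => T z' x y) (((fderiv ℝ T z).flip x).flip y) z := by
  have c (a : Model m) : HasFDerivAt (𝕜 := ℝ) (fun _ : Model m => a) 0 z := hasFDerivAt_const a z
  refine ((h.hasFDerivAt.clm_apply (c x)).clm_apply (c y)).congr_fderiv ?_
  ext u; simp

/-- `(φ, ξ, η, G)` is a smooth Sasaki-like almost contact B-metric structure on the open set `U`;
nondegeneracy of `G` is required in place of a signature, and smoothness of `η` is automatic from
`η = G(ξ, ·)`. -/
structure IsSasakiLikeOn (U : Set (Model m)) (G : Model m → Model m →L[ℝ] Model m →L[ℝ] ℝ)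
    (φ : Model m → Model m →L[ℝ] Model m) (ξ : Model m → Model m)
    (η : Model m → Model m →L[ℝ] ℝ) : Prop extends IsMetricOn U G where
  smooth_φ : ContDiffOn ℝ ∞ φ U
  smooth_ξ : ContDiffOn ℝ ∞ ξ U
  φ_ξ : ∀ z ∈ U, φ z (ξ z) = 0
  φ_φ : ∀ z ∈ U, ∀ x, φ z (φ z x) = -x + η z x • ξ z
  η_φ : ∀ z ∈ U, ∀ x, η z (φ z x) = 0
  η_ξ : ∀ z ∈ U, η z (ξ z) = 1
  g_φ_φ : ∀ z ∈ U, ∀ x y, G z (φ z x) (φ z y) = -G z x y + η z x * η z y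
  sasaki : ∀ z ∈ U, ∀ x y, covDerivEnd G φ z x y =
    -(G z x y) • ξ z - (η z y) • x + (2 * η z x * η z y) • ξ z

namespace IsSasakiLikeOn

variable {U : Set (Model m)} {G : Model m → Model m →L[ℝ] Model m →L[ℝ] ℝ}
  {φ : Model m → Model m →L[ℝ] Model m} {ξ : Model m → Model m} {η : Model m → Model m →L[ℝ] ℝ}
  (h : IsSasakiLikeOn U G φ ξ η) {z : Model m} (hz : z ∈ U)
include h hz

theorem g_ξ_left (x : Model m) : G z (ξ z) x = η z x := by
  have := h.g_φ_φ z hz (ξ z) x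
  simp only [h.φ_ξ z hz, h.η_ξ z hz, map_zero, zero_apply] at this
  linarith

theorem g_ξ_right (x : Model m) : G z x (ξ z) = η z x := by
  rw [h.symm z hz, h.g_ξ_left hz]

theorem g_φ (x y : Model m) : G z (φ z x) y = G z x (φ z y) := by
  have h1 := h.g_φ_φ z hz (φ z x) y
  simp only [h.φ_φ z hz, h.η_φ z hz, map_add, map_neg, map_smul, add_apply, neg_apply, smul_apply,
    h.g_ξ_left hz, smul_eq_mul] at h1
  linarith

theorem differentiableAt_φ : DifferentiableAt ℝ φ z :=
  (h.smooth_φ.contDiffAt (h.isOpen.mem_nhds hz)).differentiableAt (by simp)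

theorem differentiableAt_ξ : DifferentiableAt ℝ ξ z :=
  (h.smooth_ξ.contDiffAt (h.isOpen.mem_nhds hz)).differentiableAt (by simp)

theorem fderiv_φ (x y : Model m) : fderiv ℝ φ z x y =
    -(G z x y) • ξ z - (η z y) • x + (2 * η z x * η z y) • ξ z
      - christoffelCLM G z x (φ z y) + φ z (christoffelCLM G z x y) := by
  have := h.sasaki z hz x y
  simp only [covDerivEnd, christoffel_eq] at this
  linear_combination (norm := module) this

omit hz in
theorem smooth_η : ContDiffOn ℝ ∞ η U :=
  (h.smooth.clm_apply h.smooth_ξ).congr fun z hz => by ext x; exact (h.g_ξ_left hz x).symm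

/-- In invariant form, `∇ₓ ξ = -φ x`. -/
theorem fderiv_ξ (x : Model m) : fderiv ℝ ξ z x = -φ z x - christoffelCLM G z x (ξ z) := by
  have hzU := h.isOpen.mem_nhds hz
  have d1 := (h.differentiableAt_φ hz).hasFDerivAt.clm_apply (h.differentiableAt_ξ hz).hasFDerivAt
  have e1 := d1.unique ((hasFDerivAt_const (0 : Model m) z).congr_of_eventuallyEq (by
    filter_upwards [hzU] with z' hz' using h.φ_ξ z' hz'))
  have e1 := congrArg (fun L : Model m →L[ℝ] Model m => L x) e1
  simp [h.fderiv_φ hz, h.g_ξ_right hz, h.η_ξ z hz, h.φ_ξ z hz] at e1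
  have d2 := ((h.differentiableAt hz).hasFDerivAt.clm_apply
    (h.differentiableAt_ξ hz).hasFDerivAt).clm_apply (h.differentiableAt_ξ hz).hasFDerivAt
  have e2 := d2.unique ((hasFDerivAt_const (1 : ℝ) z).congr_of_eventuallyEq (by
    filter_upwards [hzU] with z' hz'
    rw [h.g_ξ_left hz', h.η_ξ z' hz']))
  have e2 := congrArg (fun L : Model m →L[ℝ] ℝ => L x) e2
  simp [h.fderiv_eq hz, h.g_ξ_right hz, h.g_ξ_left hz] at e2
  -- `w = ∇ₓ ξ + φ x` is killed by both `η` and `φ`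
  set w := fderiv ℝ ξ z x + christoffelCLM G z x (ξ z) + φ z x with hw
  have hη : η z w = 0 := by
    simp only [hw, map_add, h.η_φ z hz]
    linarith
  have hφ : φ z w = 0 := by
    simp only [hw, map_add, h.φ_φ z hz]
    rw [← e1]; module
  have := h.φ_φ z hz w
  rw [hφ, hη] at this
  simp at this
  rw [hw] at this
  linear_combination (norm := module) this

/-- In invariant form, `(∇ᵤ η)(y) = -G(u, φ y)`. -/
theorem fderiv_η (u y : Model m) :
    fderiv ℝ η z u y = η z (christoffelCLM G z u y) - G z u (φ z y) := by
  have hzU := h.isOpen.mem_nhds hz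
  have d := (h.differentiableAt hz).hasFDerivAt.clm_apply (h.differentiableAt_ξ hz).hasFDerivAt
  have e := d.congr_of_eventuallyEq (f₁ := η) (by
    filter_upwards [hzU] with z' hz'
    ext x; exact (h.g_ξ_left hz' x).symm)
  rw [e.fderiv]
  simp [h.fderiv_ξ hz, h.fderiv_eq hz, h.g_ξ_left hz, h.g_φ hz]
  ring

theorem fderiv_fderiv_ξ (u x : Model m) : fderiv ℝ (fderiv ℝ ξ) z u x =
    -fderiv ℝ φ z u x - fderiv ℝ (christoffelCLM G) z u x (ξ z)
      - christoffelCLM G z x (fderiv ℝ ξ z u) := by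
  have hzU := h.isOpen.mem_nhds hz
  have c (a : Model m) : HasFDerivAt (𝕜 := ℝ) (fun _ : Model m => a) 0 z := hasFDerivAt_const a z
  have a1 : ContDiffAt ℝ ∞ (fderiv ℝ ξ) z := (h.smooth_ξ.contDiffAt hzU).fderiv_right (by simp)
  have d1 := (a1.differentiableAt (by simp)).hasFDerivAt.clm_apply (c x)
  have d2 := (((h.differentiableAt_φ hz).hasFDerivAt.clm_apply (c x)).neg).sub
    (((h.differentiableAt_christoffel hz).hasFDerivAt.clm_apply (c x)).clm_apply
      (h.differentiableAt_ξ hz).hasFDerivAt)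
  have e := (d1.congr_of_eventuallyEq (by
    filter_upwards [hzU] with z' hz' using (h.fderiv_ξ hz' x).symm)).unique d2
  have e := congrArg (fun L : Model m →L[ℝ] Model m => L u) e
  simp at e
  rw [e]; module

/-- The covariant derivative of `∇ ξ = -φ` gives the curvature in the direction of `ξ`. -/
theorem curv_ξ (x y : Model m) :
    curv (christoffelCLM G) z x y (ξ z) = η z y • x - η z x • y := by
  have s : IsSymmSndFDerivAt ℝ ξ z :=
    (h.smooth_ξ.contDiffAt (h.isOpen.mem_nhds hz)).isSymmSndFDerivAt minSmoothness_le_infty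
  have e := s x y
  simp only [h.fderiv_fderiv_ξ hz, h.fderiv_φ hz, h.fderiv_ξ hz, map_sub, map_neg] at e
  rw [h.christoffel_symm hz y x, h.symm z hz y x] at e
  simp only [curv]
  linear_combination (norm := module) -e

theorem curv_ξ_left (x y : Model m) :
    curv (christoffelCLM G) z (ξ z) x y = G z x y • ξ z - η z y • x :=
  h.ext hz fun t => by
    rw [h.curv_pair hz, h.curv_ξ hz]
    simp [h.g_ξ_left hz, h.symm z hz y x, h.symm z hz t x]
    ring

/-- `L_ξ ∇ = 2 (G - η ⊗ η) ⊗ ξ`, from `(L_ξ ∇)(x, y) = ∇²_{x, y} ξ + R(ξ, x) y`. -/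
theorem lieConn_ξ (x y : Model m) : lieConn ξ (christoffelCLM G) z x y =
    (2 * (G z x y - η z x * η z y)) • ξ z := by
  have e := h.curv_ξ_left hz x y
  have hs (u x y : Model m) : fderiv ℝ (christoffelCLM G) z u x y =
      fderiv ℝ (christoffelCLM G) z u y x := h.fderiv_christoffel_symm hz u x y
  simp only [curv] at e
  simp only [lieConn, h.fderiv_fderiv_ξ hz, h.fderiv_φ hz, h.fderiv_ξ hz, map_sub, map_neg,
    sub_apply, neg_apply]
  rw [hs x y, h.christoffel_symm hz y (φ z x),
    h.christoffel_symm hz y (christoffelCLM G z x (ξ z))]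
  rw [h.christoffel_symm hz (ξ z) y, h.christoffel_symm hz (ξ z)] at e
  linear_combination (norm := module) e

end IsSasakiLikeOn

end Coord

/-! ### Invariance of the Ricci tensor along `ξ` -/

namespace Coord

open AffineConnection

variable {m : ℕ}

/-- The horizontal symmetric forms `β (g - η ⊗ η) + γ g(·, φ ·)`, for constants `β`, `γ`. -/
def horizForm (β γ : ℝ) (G : Model m → Model m →L[ℝ] Model m →L[ℝ] ℝ)
    (φ : Model m → Model m →L[ℝ] Model m) (η : Model m → Model m →L[ℝ] ℝ) (z : Model m) :
    Model m →L[ℝ] Model m →L[ℝ] ℝ :=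
  β • (G z - (η z).smulRight (η z)) + γ • (ContinuousLinearMap.precomp ℝ (φ z)).comp (G z)

/-- The vector-valued bilinear form `S ⊗ ξ`. -/
def formTimes (S : Model m → Model m →L[ℝ] Model m →L[ℝ] ℝ) (ξ : Model m → Model m)
    (z : Model m) : Model m →L[ℝ] Model m →L[ℝ] Model m :=
  ((ContinuousLinearMap.smulRightL ℝ (Model m) (Model m)).flip (ξ z)).comp (S z)

theorem formTimes_apply (S : Model m → Model m →L[ℝ] Model m →L[ℝ] ℝ) (ξ : Model m → Model m)
    (z x y : Model m) : formTimes S ξ z x y = S z x y • ξ z := by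
  simp [formTimes]

theorem horizForm_apply (β γ : ℝ) (G : Model m → Model m →L[ℝ] Model m →L[ℝ] ℝ)
    (φ : Model m → Model m →L[ℝ] Model m) (η : Model m → Model m →L[ℝ] ℝ) (z x y : Model m) :
    horizForm β γ G φ η z x y = β * (G z x y - η z x * η z y) + γ * G z x (φ z y) := by
  simp [horizForm]

theorem IsMetricOn.ricci_eq {U : Set (Model m)} {G : Model m → Model m →L[ℝ] Model m →L[ℝ] ℝ}
    (hG : IsMetricOn U G) {z : Model m} (hz : z ∈ U) (x y : Model m) :
    ricci G z x y = tr fun u => curv (christoffelCLM G) z u x y := by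
  simp only [ricci, tr, hG.curvature_eq hz]

theorem isLinearMap_curv (Γ : Model m → Model m →L[ℝ] Model m →L[ℝ] Model m) (z x y : Model m) :
    IsLinearMap ℝ fun u => curv Γ z u x y :=
  ⟨fun u v => by simp [curv]; module, fun a u => by simp [curv]; module⟩

/-- The Lie derivative commutes with the contraction of the curvature to the Ricci tensor. -/
theorem IsMetricOn.tr_lieCurv {U : Set (Model m)}
    {G : Model m → Model m →L[ℝ] Model m →L[ℝ] ℝ} (hG : IsMetricOn U G) {z : Model m} (hz : z ∈ U)
    (ξ : Model m → Model m) (x y : Model m) :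
    tr (fun u => lieCurv ξ (christoffelCLM G) z u x y) =
      fderiv ℝ (fun z' => ricci G z' x y) z (ξ z) + ricci G z (fderiv ℝ ξ z x) y
        + ricci G z x (fderiv ℝ ξ z y) := by
  have hzU := hG.isOpen.mem_nhds hz
  have aΓ := hG.contDiffOn_christoffel.contDiffAt hzU
  have dΓ1 := (aΓ.fderiv_right (m := ∞) (by simp)).differentiableAt (by simp)
  have dc (u : Model m) := (fderiv_curv (hG.differentiableAt_christoffel hz) dΓ1 u x y 0).1
  have hproj (i : Fin m) (u : Model m) := (EuclideanSpace.proj (𝕜 := ℝ) i).hasFDerivAt.comp z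
    (dc u).hasFDerivAt
  have e1 : HasFDerivAt (fun z' => ricci G z' x y) _ z :=
    (HasFDerivAt.fun_sum (u := Finset.univ) fun i _ => hproj i (basisVec i)).congr_of_eventuallyEq
      (by filter_upwards [hzU] with z' hz' using by simp [hG.ricci_eq hz', tr])
  have e2 : fderiv ℝ (fun z' => ricci G z' x y) z (ξ z) =
      tr fun u => fderiv ℝ (fun z' => curv (christoffelCLM G) z' u x y) z (ξ z) := by
    rw [e1.fderiv]; simp [tr]
  rw [e2, hG.ricci_eq hz, hG.ricci_eq hz]
  simp only [lieCurv]
  rw [tr_sub, tr_add, tr_add, tr_add, tr_comp_comm _ (isLinearMap_curv _ z x y)]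
  ring

namespace IsSasakiLikeOn

variable {U : Set (Model m)} {G : Model m → Model m →L[ℝ] Model m →L[ℝ] ℝ}
  {φ : Model m → Model m →L[ℝ] Model m} {ξ : Model m → Model m} {η : Model m → Model m →L[ℝ] ℝ}
  (h : IsSasakiLikeOn U G φ ξ η)
include h

theorem smooth_horizForm (β γ : ℝ) : ContDiffOn ℝ ∞ (horizForm β γ G φ η) U := by
  refine contDiffOn_clm_apply.2 fun x => contDiffOn_clm_apply.2 fun y => ?_
  simp only [horizForm_apply]
  have hη (x : Model m) := h.smooth_η.clm_apply (contDiffOn_const (c := x))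
  have hGx := h.smooth.clm_apply (contDiffOn_const (c := x))
  exact (contDiffOn_const.mul ((hGx.clm_apply contDiffOn_const).sub ((hη x).mul (hη y)))).add
    (contDiffOn_const.mul (hGx.clm_apply (h.smooth_φ.clm_apply contDiffOn_const)))

theorem smooth_formTimes (β γ : ℝ) :
    ContDiffOn ℝ ∞ (formTimes (horizForm β γ G φ η) ξ) U := by
  refine contDiffOn_clm_apply.2 fun x => contDiffOn_clm_apply.2 fun y => ?_
  simp only [formTimes_apply]
  exact (((h.smooth_horizForm β γ).clm_apply contDiffOn_const).clm_apply
    contDiffOn_const).smul h.smooth_ξ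

variable {z : Model m} (hz : z ∈ U)
include hz

theorem differentiableAt_formTimes (β γ : ℝ) :
    DifferentiableAt ℝ (formTimes (horizForm β γ G φ η) ξ) z :=
  ((h.smooth_formTimes β γ).contDiffAt (h.isOpen.mem_nhds hz)).differentiableAt (by simp)

theorem differentiableAt_η : DifferentiableAt ℝ η z :=
  (h.smooth_η.contDiffAt (h.isOpen.mem_nhds hz)).differentiableAt (by simp)

/-- The derivative of `g(x, φ y)`. -/
theorem fderiv_g_φ (u x y : Model m) :
    HasFDerivAt (fun z' => G z' x (φ z' y)) (fderiv ℝ (fun z' => G z' x (φ z' y)) z) z ∧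
    fderiv ℝ (fun z' => G z' x (φ z' y)) z u =
      G z (christoffelCLM G z u x) (φ z y) + G z x (φ z (christoffelCLM G z u y))
      - G z u y * η z x - G z u x * η z y + 2 * η z u * η z x * η z y := by
  have c (a : Model m) : HasFDerivAt (𝕜 := ℝ) (fun _ : Model m => a) 0 z := hasFDerivAt_const a z
  have d := ((h.differentiableAt hz).hasFDerivAt.clm_apply (c x)).clm_apply
    ((h.differentiableAt_φ hz).hasFDerivAt.clm_apply (c y))
  refine ⟨d.differentiableAt.hasFDerivAt, ?_⟩
  rw [d.fderiv]
  simp [h.fderiv_φ hz, h.fderiv_eq hz, h.g_ξ_right hz, h.symm z hz x u]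
  ring

theorem fderiv_η_η (u x y : Model m) :
    HasFDerivAt (fun z' => η z' x * η z' y) (fderiv ℝ (fun z' => η z' x * η z' y) z) z ∧
    fderiv ℝ (fun z' => η z' x * η z' y) z u =
      η z (christoffelCLM G z u x) * η z y + η z x * η z (christoffelCLM G z u y)
      - G z u (φ z x) * η z y - G z u (φ z y) * η z x := by
  have c (a : Model m) : HasFDerivAt (𝕜 := ℝ) (fun _ : Model m => a) 0 z := hasFDerivAt_const a z
  have d := ((h.differentiableAt_η hz).hasFDerivAt.clm_apply (c x)).mul
    ((h.differentiableAt_η hz).hasFDerivAt.clm_apply (c y))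
  have d' : HasFDerivAt (fun z' => η z' x * η z' y) _ z := d
  refine ⟨d'.differentiableAt.hasFDerivAt, ?_⟩
  rw [d'.fderiv]
  simp [h.fderiv_η hz]
  ring

theorem fderiv_horizForm (β γ : ℝ) (u x y : Model m) :
    fderiv ℝ (horizForm β γ G φ η) z u x y =
      horizForm β γ G φ η z (christoffelCLM G z u x) y
      + horizForm β γ G φ η z x (christoffelCLM G z u y)
      + β * (G z u (φ z x) * η z y + G z u (φ z y) * η z x)
      + γ * (-(G z u y * η z x) - G z u x * η z y + 2 * η z u * η z x * η z y) := by
  have hd : DifferentiableAt ℝ (horizForm β γ G φ η) z :=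
    ((h.smooth_horizForm β γ).contDiffAt (h.isOpen.mem_nhds hz)).differentiableAt (by simp)
  have d1 := fderiv_apply₂ hd x y
  have d2 := (((fderiv_apply₂ (h.differentiableAt hz) x y).sub
    (h.fderiv_η_η hz u x y).1).const_mul β).add ((h.fderiv_g_φ hz u x y).1.const_mul γ)
  have e := (d1.congr_of_eventuallyEq (Filter.Eventually.of_forall fun z' =>
    (horizForm_apply β γ G φ η z' x y).symm)).unique d2
  have e := congrArg (fun L : Model m →L[ℝ] ℝ => L u) e
  simp [(h.fderiv_η_η hz u x y).2, (h.fderiv_g_φ hz u x y).2, h.fderiv_eq hz] at e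
  rw [e]
  simp only [horizForm_apply]
  ring

theorem covDerivBi_formTimes (β γ : ℝ) (u x y : Model m) :
    covDerivBi (christoffelCLM G) (formTimes (horizForm β γ G φ η) ξ) z u x y =
      (β * (G z u (φ z x) * η z y + G z u (φ z y) * η z x)
        + γ * (-(G z u y * η z x) - G z u x * η z y + 2 * η z u * η z x * η z y)) • ξ z
      - horizForm β γ G φ η z x y • φ z u := by
  have d1 := fderiv_apply₂ (h.differentiableAt_formTimes hz β γ) x y
  have hd : DifferentiableAt ℝ (horizForm β γ G φ η) z :=
    ((h.smooth_horizForm β γ).contDiffAt (h.isOpen.mem_nhds hz)).differentiableAt (by simp)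
  have d2 := (fderiv_apply₂ hd x y).smul (h.differentiableAt_ξ hz).hasFDerivAt
  have e := (d1.congr_of_eventuallyEq (Filter.Eventually.of_forall fun z' =>
    (formTimes_apply _ ξ z' x y).symm)).unique d2
  have e := congrArg (fun L : Model m →L[ℝ] Model m => L u) e
  simp [h.fderiv_horizForm hz, h.fderiv_ξ hz] at e
  simp only [covDerivBi, e, formTimes_apply, map_smul]
  module

theorem tr_φ : tr (fun u => φ z u) = 0 :=
  tr_eq_zero_of_cube (φ z) fun x => by
    rw [h.φ_φ z hz (φ z x), h.η_φ z hz]; simp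

/-- A change of the connection by `S ⊗ ξ`, `S` one of the forms `β (g - η ⊗ η) + γ g(·, φ ·)`, does
not affect the Ricci tensor to first order. -/
theorem tr_covDerivBi_formTimes (β γ : ℝ) (x y : Model m) :
    tr (fun u =>
      covDerivBi (christoffelCLM G) (formTimes (horizForm β γ G φ η) ξ) z u x y
      - covDerivBi (christoffelCLM G) (formTimes (horizForm β γ G φ η) ξ) z x u y) = 0 := by
  have e (u : Model m) :
      covDerivBi (christoffelCLM G) (formTimes (horizForm β γ G φ η) ξ) z u x y
      - covDerivBi (christoffelCLM G) (formTimes (horizForm β γ G φ η) ξ) z x u y =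
      (β * (G z u (φ z y) * η z x - G z x (φ z y) * η z u)
        + γ * (G z x y * η z u - G z u y * η z x)) • ξ z
      + horizForm β γ G φ η z u y • φ z x - horizForm β γ G φ η z x y • φ z u := by
    rw [h.covDerivBi_formTimes hz, h.covDerivBi_formTimes hz, h.symm z hz x u,
      ← h.g_φ hz u x, h.symm z hz (φ z u) x]
    module
  simp only [e]
  rw [tr_sub, tr_add, tr_smul, h.tr_φ hz,
    tr_smul_vector ⟨fun u v => by simp; ring, fun a u => by simp; ring⟩,
    tr_smul_vector ⟨fun u v => by simp, fun a u => by simp⟩, horizForm_apply, h.g_φ_φ z hz]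
  simp only [h.g_ξ_left hz, h.η_φ z hz, h.η_ξ z hz, h.g_φ hz]
  ring

/-- The Ricci tensor is invariant under `ξ`: `L_ξ ρ = 0`. -/
theorem lie_ricci (x y : Model m) :
    fderiv ℝ (fun z' => ricci G z' x y) z (ξ z) + ricci G z (fderiv ℝ ξ z x) y
        + ricci G z x (fderiv ℝ ξ z y) = 0 := by
  rw [← h.tr_lieCurv hz]
  simp only [lieCurv_eq h.isOpen h.contDiffOn_christoffel h.smooth_ξ
    (fun z hz => h.christoffel_symm hz) (C := formTimes (horizForm 2 0 G φ η) ξ)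
    (fun z hz x y => by rw [h.lieConn_ξ hz, formTimes_apply, horizForm_apply]; simp) hz
    (h.differentiableAt_formTimes hz 2 0)]
  exact h.tr_covDerivBi_formTimes hz 2 0 x y

theorem ricci_ξ_ξ : ricci G z (ξ z) (ξ z) = m - 1 := by
  rw [h.ricci_eq hz]
  simp only [h.curv_ξ hz, h.η_ξ z hz, one_smul]
  rw [tr_sub, tr_id, tr_smul_vector (α := fun u => η z u) (η z).isLinear, h.η_ξ z hz]

/-- An Einstein-like Ricci tensor is a multiple of `η ⊗ η`: by `L_ξ ρ = 0`, its horizontal part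
vanishes. -/
theorem ricci_eq_of_einstein {a b c : ℝ} (hE : ∀ z ∈ U, ∀ x y, ricci G z x y =
    a * G z x y + b * (G z x (φ z y) + η z x * η z y) + c * (η z x * η z y)) (x y : Model m) :
    ricci G z x y = (m - 1) * (η z x * η z y) := by
  have hzU := h.isOpen.mem_nhds hz
  have habc : a + b + c = m - 1 := by
    rw [← h.ricci_ξ_ξ hz, hE z hz, h.φ_ξ z hz, h.g_ξ_left hz, h.η_ξ z hz]; simp
  -- the Lie derivative of `a g + b g̃ + c η ⊗ η` along `ξ` is `2 b (g - η ⊗ η) - 2 a g(·, φ ·)`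
  have key (x y : Model m) : b * (G z x y - η z x * η z y) = a * G z x (φ z y) := by
    have d := (((fderiv_apply₂ (h.differentiableAt hz) x y).const_mul a).add
      (((h.fderiv_g_φ hz (ξ z) x y).1.add (h.fderiv_η_η hz (ξ z) x y).1).const_mul b)).add
      ((h.fderiv_η_η hz (ξ z) x y).1.const_mul c)
    have d' : HasFDerivAt (fun z' => ricci G z' x y) _ z := d.congr_of_eventuallyEq (by
      filter_upwards [hzU] with z' hz' using hE z' hz' x y)
    have l := h.lie_ricci hz x y
    rw [d'.fderiv, hE z hz, hE z hz] at l
    simp [h.fderiv_eq hz, (h.fderiv_η_η hz (ξ z) x y).2, (h.fderiv_g_φ hz (ξ z) x y).2,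
      h.fderiv_ξ hz, h.g_ξ_left hz, h.η_φ z hz, h.η_ξ z hz, h.φ_φ z hz,
      h.christoffel_symm hz _ (ξ z), h.g_φ hz, h.g_ξ_right hz] at l
    linarith
  -- replacing `y` by `φ y` turns this into the vanishing of `a (g - η ⊗ η) + b g(·, φ ·)`
  have k2 := key x (φ z y)
  simp only [h.η_φ z hz, h.φ_φ z hz, map_add, map_neg, map_smul, h.g_ξ_right hz,
    smul_eq_mul] at k2
  rw [hE z hz, ← habc]
  linear_combination k2

end IsSasakiLikeOn

end Coord

/-! ### The associated metric and the scalar curvatures -/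

namespace Coord

open AffineConnection

variable {m : ℕ}

/-- The curvature of `∇ + C`, for a torsion-free connection `∇`. -/
theorem curv_add {Γ C : Model m → Model m →L[ℝ] Model m →L[ℝ] Model m} {z : Model m}
    (hΓ : DifferentiableAt ℝ Γ z) (hC : DifferentiableAt ℝ C z)
    (hsymm : ∀ x y, Γ z x y = Γ z y x) (u x y : Model m) :
    curv (fun z' => Γ z' + C z') z u x y = curv Γ z u x y
      + (covDerivBi Γ C z u x y - covDerivBi Γ C z x u y)
      + (C z u (C z x y) - C z x (C z u y)) := by
  have e : fderiv ℝ (fun z' => Γ z' + C z') z = fderiv ℝ Γ z + fderiv ℝ C z := fderiv_fun_add hΓ hC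
  simp only [curv, covDerivBi, e, add_apply, map_add]
  rw [hsymm x u]
  module

/-- If `ρ = k η ⊗ η` where `η` is dual to the unit vector `ξ`, the scalar curvature is `k`. -/
theorem IsMetricOn.scalarCurvature_eq {U : Set (Model m)}
    {B : Model m → Model m →L[ℝ] Model m →L[ℝ] ℝ} (hB : IsMetricOn U B) {z : Model m} (hz : z ∈ U)
    {ξ : Model m} {η : Model m →L[ℝ] ℝ} (hξ : ∀ x, B z x ξ = η x) (hη : η ξ = 1) {k : ℝ}
    (hk : ∀ x y, ricci B z x y = k * (η x * η y)) : scalarCurvature B z = k := by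
  -- the Gram matrix sends `ξ` to the components of `η`, hence its inverse sends `η` to `ξ`
  have hmul (v : Fin m → ℝ) (i : Fin m) :
      (gram B z *ᵥ v) i = B z (basisVec i) (WithLp.toLp 2 v) := by
    conv_rhs => rw [← sum_basisVec (WithLp.toLp 2 v)]
    simp [Matrix.mulVec, dotProduct, gram, mul_comm]
  have hunit : IsUnit (gram B z).det := by
    rw [← Matrix.isUnit_iff_isUnit_det, ← Matrix.mulVec_injective_iff_isUnit]
    refine (injective_iff_map_eq_zero (gram B z).mulVecLin).2 fun v hv => ?_
    have h0 : WithLp.toLp 2 v = (0 : Model m) := hB.nondeg z hz _ fun y => by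
      rw [hB.symm z hz, ← sum_basisVec y]
      have (i : Fin m) : B z (basisVec i) (WithLp.toLp 2 v) = 0 := by
        rw [← hmul]; exact congrFun hv i
      simp [this]
    simpa using congrArg WithLp.ofLp h0
  have hw : gram B z *ᵥ ξ.ofLp = fun i => η (basisVec i) := by
    ext i; rw [hmul]; exact hξ _
  have hw' : (gram B z)⁻¹ *ᵥ (fun i => η (basisVec i)) = ξ.ofLp := by
    rw [← hw, Matrix.mulVec_mulVec, Matrix.nonsing_inv_mul _ hunit, Matrix.one_mulVec]
  have hs : ∑ i, η (basisVec i) * ξ i = 1 := by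
    rw [← hη]
    conv_rhs => rw [← sum_basisVec ξ]
    simp [mul_comm]
  calc scalarCurvature B z
      = k * ∑ i, η (basisVec i) * ((gram B z)⁻¹ *ᵥ fun i => η (basisVec i)) i := by
        simp only [scalarCurvature, hk, Matrix.mulVec, dotProduct, Finset.mul_sum]
        exact Finset.sum_congr rfl fun i _ => Finset.sum_congr rfl fun j _ => by ring
    _ = k := by rw [hw', hs, mul_one]

namespace IsSasakiLikeOn

variable {U : Set (Model m)} {G Gt : Model m → Model m →L[ℝ] Model m →L[ℝ] ℝ}
  {φ : Model m → Model m →L[ℝ] Model m} {ξ : Model m → Model m} {η : Model m → Model m →L[ℝ] ℝ}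
  (h : IsSasakiLikeOn U G φ ξ η)
  (hGt : ∀ z ∈ U, ∀ x y, Gt z x y = G z x (φ z y) + η z x * η z y)
include h hGt

theorem isMetricOn_associated : IsMetricOn U Gt where
  isOpen := h.isOpen
  smooth := by
    refine contDiffOn_clm_apply.2 fun x => contDiffOn_clm_apply.2 fun y => ?_
    refine ContDiffOn.congr ?_ fun z hz => hGt z hz x y
    have hη (x : Model m) := h.smooth_η.clm_apply (contDiffOn_const (c := x))
    have hGx := h.smooth.clm_apply (contDiffOn_const (c := x))
    exact (hGx.clm_apply (h.smooth_φ.clm_apply contDiffOn_const)).add ((hη x).mul (hη y))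
  symm z hz x y := by
    rw [hGt z hz, hGt z hz, ← h.g_φ hz, h.symm z hz]; ring
  nondeg z hz x hx := by
    have h1 : η z x = 0 := by
      have := hx (ξ z)
      rw [hGt z hz, h.φ_ξ z hz, h.η_ξ z hz] at this
      simpa using this
    refine h.nondeg z hz x fun y => ?_
    have := hx (φ z y)
    rw [hGt z hz, h.φ_φ z hz, h1] at this
    simpa [h.g_ξ_right hz, h1] using this

variable {z : Model m} (hz : z ∈ U)
include hz

/-- The Levi-Civita connections of the two metrics differ by
`-(g - η ⊗ η + g(·, φ ·)) ⊗ ξ`. -/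
theorem christoffel_associated : christoffelCLM Gt z =
    christoffelCLM G z + formTimes (horizForm (-1) (-1) G φ η) ξ z := by
  ext1 x; ext1 y
  refine (h.isMetricOn_associated hGt).christoffel_unique hz (D := fun x y =>
    (christoffelCLM G z + formTimes (horizForm (-1) (-1) G φ η) ξ z) x y) (fun x y => ?_)
    (fun u x y => ?_) x y
  · simp only [add_apply, formTimes_apply, horizForm_apply]
    rw [h.christoffel_symm hz x y, h.symm z hz x y, ← h.g_φ hz x, h.symm z hz (φ z x)]
    congr 2; ring
  · have d := (h.fderiv_g_φ hz u x y).1.add (h.fderiv_η_η hz u x y).1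
    have e := (fderiv_apply₂ ((h.isMetricOn_associated hGt).differentiableAt hz) x y).unique
      (d.congr_of_eventuallyEq (by
        filter_upwards [h.isOpen.mem_nhds hz] with z' hz' using hGt z' hz' x y))
    have e := congrArg (fun L : Model m →L[ℝ] ℝ => L u) e
    simp [(h.fderiv_η_η hz u x y).2, (h.fderiv_g_φ hz u x y).2] at e
    rw [e, hGt z hz, hGt z hz]
    simp [formTimes_apply, horizForm_apply, h.g_ξ_left hz, h.η_φ z hz, h.η_ξ z hz, h.φ_ξ z hz]
    ring

/-- The term of second order in the difference `S ⊗ ξ` vanishes too, because `S(·, ξ) = 0`. -/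
theorem ricci_associated (x y : Model m) : ricci Gt z x y = ricci G z x y := by
  have hC (u x y : Model m) : formTimes (horizForm (-1) (-1) G φ η) ξ z u
      (formTimes (horizForm (-1) (-1) G φ η) ξ z x y) = 0 := by
    simp [formTimes_apply, horizForm_apply, h.g_ξ_right hz, h.η_ξ z hz, h.φ_ξ z hz]
  have e (u : Model m) : curv (christoffelCLM Gt) z u x y = curv (christoffelCLM G) z u x y +
      (covDerivBi (christoffelCLM G) (formTimes (horizForm (-1) (-1) G φ η) ξ) z u x y
      - covDerivBi (christoffelCLM G) (formTimes (horizForm (-1) (-1) G φ η) ξ) z x u y) := by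
    have ev : christoffelCLM Gt =ᶠ[nhds z] fun z' =>
        christoffelCLM G z' + formTimes (horizForm (-1) (-1) G φ η) ξ z' := by
      filter_upwards [h.isOpen.mem_nhds hz] with z' hz' using h.christoffel_associated hGt hz'
    have := curv_add (h.differentiableAt_christoffel hz) (h.differentiableAt_formTimes hz (-1) (-1))
      (h.christoffel_symm hz) u x y
    rw [hC, hC] at this
    simp only [curv, ev.fderiv_eq, ev.eq_of_nhds] at this ⊢
    rw [this]; module
  rw [(h.isMetricOn_associated hGt).ricci_eq hz, h.ricci_eq hz]
  simp only [e]
  rw [tr_add, h.tr_covDerivBi_formTimes hz, add_zero]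

end IsSasakiLikeOn

end Coord

/-! ### Smoothness of coordinate expressions -/

section Transfer

open Coord

variable {m : ℕ} {M : Type*} [TopologicalSpace M] [ChartedSpace (Model m) M]
  [IsManifold (𝓡 m) ∞ M] {e : OpenPartialHomeomorph M (Model m)}
  (he : e ∈ IsManifold.maximalAtlas (𝓡 m) ∞ M)
include he

omit [IsManifold (𝓡 m) ∞ M] in
theorem mdifferentiable_of_mem_maximalAtlas : e.MDifferentiable (𝓡 m) (𝓡 m) :=
  ⟨(contMDiffOn_of_mem_maximalAtlas he).mdifferentiableOn (by simp),
    (contMDiffOn_symm_of_mem_maximalAtlas he).mdifferentiableOn (by simp)⟩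

omit [IsManifold (𝓡 m) ∞ M] in
theorem chartFrame_isInvertible {z : Model m} (hz : z ∈ e.target) :
    (chartFrame e z).IsInvertible :=
  ⟨(mdifferentiable_of_mem_maximalAtlas he).symm.mfderiv hz, rfl⟩

omit [IsManifold (𝓡 m) ∞ M] in
theorem chartFrame_inverse {z : Model m} (hz : z ∈ e.target) :
    (chartFrame e z).inverse = mfderiv (𝓡 m) 𝓘(ℝ, Model m) e (e.symm z) := by
  have hd := mdifferentiable_of_mem_maximalAtlas he
  refine ContinuousLinearMap.inverse_eq ?_ ?_
  · have := hd.symm_comp_deriv (e.map_target hz)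
    rwa [e.right_inv hz] at this
  · exact hd.comp_symm_deriv hz

/-- The coordinate fields of a chart, with constant coefficients, are smooth. -/
theorem contMDiffOn_chartFrame (x : Model m) :
    ContMDiffOn 𝓘(ℝ, Model m) (𝓡 m).tangent ∞
      (fun z => (⟨e.symm z, chartFrame e z x⟩ : TangentBundle (𝓡 m) M)) e.target := by
  have : IsManifold (𝓡 m) 1 M := IsManifold.of_le (n := ∞) (by simp)
  have h1 : ContMDiffOn 𝓘(ℝ, Model m) (𝓡 m).tangent ∞
      (fun z => (⟨z, x⟩ : TangentBundle 𝓘(ℝ, Model m) (Model m))) e.target := fun z _ =>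
    contMDiffWithinAt_vectorSpace_iff_contDiffWithinAt.2 contDiffWithinAt_const
  have h2 := (contMDiffOn_symm_of_mem_maximalAtlas he).contMDiffOn_tangentMapWithin (m := ∞)
    (by simp) e.open_target.uniqueMDiffOn
  refine (h2.comp h1 fun z hz => hz).congr fun z hz => ?_
  simp only [Function.comp_apply, tangentMapWithin, chartFrame,
    mfderivWithin_of_isOpen e.open_target hz]
  rfl

/-- The components of a smooth vector field in a chart are smooth. -/
theorem contDiffOn_inverse_chartFrame {X : (z : Model m) → TangentSpace (𝓡 m) (e.symm z)}
    (hX : ContMDiffOn 𝓘(ℝ, Model m) (𝓡 m).tangent ∞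
      (fun z => (⟨e.symm z, X z⟩ : TangentBundle (𝓡 m) M)) e.target) :
    ContDiffOn ℝ ∞ (fun z => (chartFrame e z).inverse (X z)) e.target := by
  have : IsManifold (𝓡 m) 1 M := IsManifold.of_le (n := ∞) (by simp)
  have h2 := (contMDiffOn_of_mem_maximalAtlas he).contMDiffOn_tangentMapWithin (m := ∞)
    (by simp) e.open_source.uniqueMDiffOn
  have h3 := (contMDiff_snd_tangentBundle_modelSpace (Model m) (𝓡 m) (n := ∞)).comp_contMDiffOn
    (h2.comp hX fun z hz => e.map_target hz)
  refine contMDiffOn_iff_contDiffOn.1 (h3.congr fun z hz => ?_)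
  rw [chartFrame_inverse he hz, ← mfderivWithin_of_isOpen e.open_source (e.map_target hz)]
  rfl

theorem contDiffOn_coordVec {X : (p : M) → TangentSpace (𝓡 m) p} (hX : SmoothVec X) :
    ContDiffOn ℝ ∞ (coordVec e X) e.target :=
  contDiffOn_inverse_chartFrame he
    (ContMDiff.comp_contMDiffOn hX (contMDiffOn_symm_of_mem_maximalAtlas he))

theorem contDiffOn_coordEnd
    {P : (p : M) → TangentSpace (𝓡 m) p →L[ℝ] TangentSpace (𝓡 m) p} (hP : SmoothEnd P) :
    ContDiffOn ℝ ∞ (coordEnd e P) e.target := by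
  refine contDiffOn_clm_apply.2 fun x => ?_
  refine contDiffOn_inverse_chartFrame he (X := fun z => P (e.symm z) (chartFrame e z x)) ?_
  exact ContMDiffOn.clm_bundle_apply
    (ContMDiff.comp_contMDiffOn hP (contMDiffOn_symm_of_mem_maximalAtlas he))
    (contMDiffOn_chartFrame he x)

theorem contDiffOn_coordBilin
    {B : (p : M) → TangentSpace (𝓡 m) p →L[ℝ] TangentSpace (𝓡 m) p →L[ℝ] ℝ}
    (hB : SmoothBilin B) : ContDiffOn ℝ ∞ (coordBilin e B) e.target := by
  refine contDiffOn_clm_apply.2 fun x => contDiffOn_clm_apply.2 fun y => ?_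
  have h : ContMDiffOn 𝓘(ℝ, Model m) ((𝓡 m).prod 𝓘(ℝ)) ∞
      (fun z => Bundle.TotalSpace.mk' ℝ (E := Bundle.Trivial M ℝ) (e.symm z)
        (B (e.symm z) (chartFrame e z x) (chartFrame e z y))) e.target := by
    apply ContMDiffOn.clm_bundle_apply₂ (F₁ := Model m) (F₂ := Model m)
    · exact ContMDiff.comp_contMDiffOn hB (contMDiffOn_symm_of_mem_maximalAtlas he)
    · exact contMDiffOn_chartFrame he x
    · exact contMDiffOn_chartFrame he y
  refine contMDiffOn_iff_contDiffOn.1 fun z hz => ?_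
  have := h z hz
  simp only [Bundle.contMDiffWithinAt_totalSpace] at this
  exact this.2

end Transfer

/-! ### Coordinate expression of a Sasaki-like structure -/

namespace AlmostContactBMetric

open Coord

variable {n : ℕ} {M : Type*} [TopologicalSpace M] [ChartedSpace (Model (2 * n + 1)) M]
  [IsManifold (𝓡 (2 * n + 1)) ∞ M] (S : AlmostContactBMetric n M)

/-- The signature makes `g` nondegenerate. -/
theorem g_nondeg (p : M) (x : TangentSpace (𝓡 (2 * n + 1)) p) (hx : ∀ y, S.g p x y = 0) :
    x = 0 := by
  obtain ⟨b, hb, hb1, hb2⟩ := S.g_signature p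
  have hcoef (i) : b.repr x i * S.g p (b i) (b i) = 0 := by
    rw [← hx (b i)]
    conv_rhs => rw [← b.sum_repr x]
    rw [map_sum, _root_.sum_apply, Finset.sum_eq_single i]
    · simp
    · intro j _ hj; simp [hb j i hj]
    · simp
  refine b.repr.map_eq_zero_iff.1 (Finsupp.ext fun i => ?_)
  rcases i with i | i
  · simpa [hb1] using hcoef (Sum.inl i)
  · simpa [hb2] using hcoef (Sum.inr i)

variable {S} (hS : S.IsSasakiLike)
  {e : OpenPartialHomeomorph M (Model (2 * n + 1))}
  (he : e ∈ IsManifold.maximalAtlas (𝓡 (2 * n + 1)) ∞ M)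
include hS he

/-- The coordinate expression of a Sasaki-like structure in any chart is Sasaki-like. -/
theorem isSasakiLikeOn_target :
    IsSasakiLikeOn e.target (coordBilin e S.g) (coordEnd e S.φ) (coordVec e S.ξ)
      (coordForm e S.η) := by
  have right_inv {z} (hz : z ∈ e.target) (v) : chartFrame e z ((chartFrame e z).inverse v) = v :=
    (chartFrame_isInvertible he hz).self_apply_inverse v
  have left_inv {z} (hz : z ∈ e.target) (v) : (chartFrame e z).inverse (chartFrame e z v) = v :=
    (chartFrame_isInvertible he hz).inverse_apply_self v
  refine
    { isOpen := e.open_target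
      smooth := contDiffOn_coordBilin he S.smooth_g
      symm := fun z hz x y => S.g_symm _ _ _
      nondeg := fun z hz x hx => ?_
      smooth_φ := contDiffOn_coordEnd he S.smooth_φ
      smooth_ξ := contDiffOn_coordVec he S.smooth_ξ
      φ_ξ := fun z hz => ?_
      φ_φ := fun z hz x => ?_
      η_φ := fun z hz x => ?_
      η_ξ := fun z hz => ?_
      g_φ_φ := fun z hz x y => ?_
      sasaki := fun z hz => hS e he z hz }
  · have h0 : chartFrame e z x = 0 := S.g_nondeg _ _ fun y => by
      rw [← right_inv hz y]; exact hx _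
    rw [← left_inv hz x, h0, map_zero]
  · simp [coordEnd, coordVec, right_inv hz, S.φ_ξ]
  · simp [coordEnd, coordVec, coordForm, right_inv hz, left_inv hz, S.φ_φ]
  · simp [coordEnd, coordForm, right_inv hz, S.η_φ]
  · simp [coordVec, coordForm, right_inv hz, S.η_ξ]
  · simp [coordEnd, coordForm, coordBilin, right_inv hz, S.g_φ_φ]

omit hS in
theorem coordBilin_gTilde {z : Model (2 * n + 1)} (hz : z ∈ e.target) (x y : Model (2 * n + 1)) :
    coordBilin e S.gTilde z x y = coordBilin e S.g z x (coordEnd e S.φ z y)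
      + coordForm e S.η z x * coordForm e S.η z y := by
  simp [coordBilin, coordEnd, coordForm, gTilde_apply,
    (chartFrame_isInvertible he hz).self_apply_inverse]

end AlmostContactBMetric

end

/-- On an Einstein-like Sasaki-like almost contact B-metric manifold of dimension `2n+1` that admits
a Ricci-like soliton with potential `v`, one has `ρ = 2n η ⊗ η` and both scalar curvatures, of `g`
and of `g̃`, equal `2n`. -/
theorem theorem3p3 (n : ℕ) (M : Type*) [TopologicalSpace M]
    [ChartedSpace (Model (2 * n + 1)) M] [IsManifold (𝓡 (2 * n + 1)) ∞ M]
    (S : AlmostContactBMetric n M) (hSasaki : S.IsSasakiLike) (hEinstein : S.IsEinsteinLike)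
    (v : (p : M) → TangentSpace (𝓡 (2 * n + 1)) p) (hv : SmoothVec v)
    (hSoliton : S.AdmitsRicciLikeSoliton v) :
    ∀ e ∈ IsManifold.maximalAtlas (𝓡 (2 * n + 1)) ∞ M, ∀ z ∈ e.target,
      (∀ x y : Model (2 * n + 1),
        Coord.ricci (coordBilin e S.g) z x y =
          2 * n * (coordForm e S.η z x * coordForm e S.η z y)) ∧
      Coord.scalarCurvature (coordBilin e S.g) z = 2 * n ∧
      Coord.scalarCurvature (coordBilin e S.gTilde) z = 2 * n := by
  intro e he z hz
  obtain ⟨a, b, c, hE⟩ := hEinstein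
  have h := AlmostContactBMetric.isSasakiLikeOn_target hSasaki he
  have hGt : ∀ z ∈ e.target, ∀ x y, coordBilin e S.gTilde z x y = _ := fun z hz =>
    AlmostContactBMetric.coordBilin_gTilde he hz
  have hric (x y : Model (2 * n + 1)) : Coord.ricci (coordBilin e S.g) z x y =
      2 * n * (coordForm e S.η z x * coordForm e S.η z y) := by
    rw [h.ricci_eq_of_einstein hz (a := a) (b := b) (c := c) fun z hz x y => by
      rw [hE e he z hz, hGt z hz]]
    push_cast; ring
  refine ⟨hric, ?_, ?_⟩
  · exact h.scalarCurvature_eq hz (h.g_ξ_right hz) (h.η_ξ z hz) hric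
  · refine (h.isMetricOn_associated hGt).scalarCurvature_eq hz (fun x => ?_) (h.η_ξ z hz)
      fun x y => (h.ricci_associated hGt hz x y).trans (hric x y)
    rw [hGt z hz, h.φ_ξ z hz, h.η_ξ z hz]
    simp
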